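/- Let $G$ be a countable group with identity $e$ and $\mu$ a probability measure on $G$. For $n\ge 0$ let $\mu_n=\mu^{*n}$ be the law of $X_n=s_1\cdots s_n$, where $s_1,s_2,\dots$ are independent of law $\mu$. For $\rho\in(0,1)$ let $Y_n^\rho=r_1\cdots r_n$, where, independently for each $k$, $r_k=s_k$ with probability $1-\rho$ and $r_k=s_k'$ with probability $\rho$, the $s_k'$ being fresh independent samples of law $\mu$. Let $\pi_n^\rho$ be the joint law of $(X_n,Y_n^\rho)$ on $G\times G$; equivalently, $\pi_n^\rho$ is the $n$-fold convolution power of the measure $\pi^\rho=(1-\rho)\mu^{\mathrm{diag}}+\rho\,(\mu\times\mu)$ on $G\times G$, where $\mu^{\mathrm{diag}}$ is the law of $(s,s)$ for $s$ of law $\mu$. The random walk $(G,\mu)$ is called $\ell^1$-noise sensitive if for every $\rho\in(0,1)$ $$\|\pi_n^\rho-\mu_n\times\mu_n\|_1=\sum_{(x,y)\in G\times G}\bigl|\pi_n^\rho(x,y)-\mu_n(x)\mu_n(y)\bigr|\longrightarrow 0\qquad(n\to\infty).$$ **Theorem.** Let $D_\infty=\langle a,b\mid a^2,b^2\rangle$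 be the infinite dihedral group. 1. The simple random walk on $D_\infty$, given by $\mu(a)=\mu(b)=\tfrac12$, is not $\ell^1$-noise sensitive. 2. The lazy simple random walk on $D_\infty$, given by $\mu(a)=\mu(b)=\mu(e)=\tfrac13$, is $\ell^1$-noise sensitive. -/

import Mathlib

open Filter Topology

noncomputable section

/-- The infinite dihedral group `⟨a, b | a², b²⟩`; the generator `a` has index `true` and
the generator `b` has index `false`. -/
abbrev DInfty : Type :=
  PresentedGroup ({FreeGroup.of true ^ 2, FreeGroup.of false ^ 2} : Set (FreeGroup Bool))

namespace DInfty

def a : DInfty := PresentedGroup.of true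

def b : DInfty := PresentedGroup.of false

/-- The step distribution of the simple random walk: mass `1/2` on each of `a`, `b`. -/
def simpleStep : PMF DInfty := (PMF.uniformOfFintype (Fin 2)).map ![a, b]

/-- The step distribution of the lazy simple random walk: mass `1/3` on each of `a`, `b`, `e`. -/
def lazyStep : PMF DInfty := (PMF.uniformOfFintype (Fin 3)).map ![a, b, 1]

/-- The generators `a` and `b` map to the two basis vectors of `(ℤ/2)²`. -/
def toKlein : DInfty →* Multiplicative (ZMod 2 × ZMod 2) :=
  PresentedGroup.toGroup (f := fun i => Multiplicative.ofAdd (if i then (1, 0) else (0, 1))) (by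
    rintro r (rfl | rfl) <;> simp <;> decide)

theorem toKlein_a : toKlein a = Multiplicative.ofAdd (1, 0) := by
  simp [toKlein, a, PresentedGroup.toGroup.of]

theorem toKlein_b : toKlein b = Multiplicative.ofAdd (0, 1) := by
  simp [toKlein, b, PresentedGroup.toGroup.of]

theorem a_ne_b : a ≠ b := fun h => by
  have := congrArg toKlein h
  rw [toKlein_a, toKlein_b] at this
  exact absurd this (by decide)

theorem a_ne_one : a ≠ 1 := fun h => by
  have := congrArg toKlein h
  rw [toKlein_a, map_one] at this
  exact absurd this (by decide)

theorem b_ne_one : b ≠ 1 := fun h => by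
  have := congrArg toKlein h
  rw [toKlein_b, map_one] at this
  exact absurd this (by decide)

theorem simpleStep_mass : simpleStep a = 1 / 2 ∧ simpleStep b = 1 / 2 := by
  constructor <;>
    simp [simpleStep, PMF.map_apply, tsum_fintype, Fin.sum_univ_succ, a_ne_b, a_ne_b.symm]

theorem lazyStep_mass : lazyStep a = 1 / 3 ∧ lazyStep b = 1 / 3 ∧ lazyStep 1 = 1 / 3 := by
  refine ⟨?_, ?_, ?_⟩ <;>
    simp [lazyStep, PMF.map_apply, tsum_fintype, Fin.sum_univ_succ, a_ne_b, a_ne_b.symm,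
      a_ne_one, a_ne_one.symm, b_ne_one, b_ne_one.symm]

end DInfty

namespace NoiseSensitivity

/-- The law `μ^{∗n}` of `s₁ ⋯ sₙ`, where the `sᵢ` are independent of law `μ`. -/
def walkLaw {G : Type*} [Group G] (μ : PMF G) : ℕ → PMF G
  | 0 => PMF.pure 1
  | n + 1 => (walkLaw μ n).bind fun x => μ.map fun s => x * s

/-- The law of a pair of independent variables of laws `ξ` and `η`. -/
def prodLaw {E F : Type*} (ξ : PMF E) (η : PMF F) : PMF (E × F) :=
  ξ.bind fun x => η.map fun y => (x, y)

/-- The law of `(s, s)`, where `s` has law `ξ`. -/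
def diagLaw {E : Type*} (ξ : PMF E) : PMF (E × E) :=
  ξ.map fun x => (x, x)

/-- The law of a biased coin: `true` with probability `ρ`, `false` with probability `1 - ρ`. -/
def coin (ρ : unitInterval) : PMF Bool :=
  PMF.ofFintype (fun c => ENNReal.ofReal (if c then (ρ : ℝ) else 1 - (ρ : ℝ))) (by
    rw [Fintype.sum_bool, ← ENNReal.ofReal_add (by simpa using ρ.2.1) (by simpa using ρ.2.2)]
    simp)

/-- The law `(1 - ρ) μ^diag + ρ μ²` of one increment `(s, r)` of the pair (walk, noised walk):
with probability `ρ` the increment `s` is refreshed, that is `r` is an independent sample of `μ`,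
and otherwise `r = s`. -/
def noisedStep {G : Type*} (μ : PMF G) (ρ : unitInterval) : PMF (G × G) :=
  (coin ρ).bind fun refreshed => if refreshed then prodLaw μ μ else diagLaw μ

/-- The joint law `πₙ^ρ` of `(Xₙ, Yₙ^ρ) = (s₁, r₁) ⋯ (sₙ, rₙ)`. -/
def noisedPairLaw {G : Type*} [Group G] (μ : PMF G) (ρ : unitInterval) (n : ℕ) : PMF (G × G) :=
  walkLaw (noisedStep μ ρ) n

/-- The `ℓ¹`-distance `∑ₓ |ξ(x) - η(x)|` of two discrete probability measures
(the sum always converges). -/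
def l1Dist {E : Type*} (ξ η : PMF E) : ℝ :=
  ∑' x, |(ξ x).toReal - (η x).toReal|

/-- `‖πₙ^ρ - μ^{∗n} × μ^{∗n}‖₁ → 0` for every noise parameter `ρ ∈ (0, 1)`. -/
def IsL1NoiseSensitive {G : Type*} [Group G] (μ : PMF G) : Prop :=
  ∀ ρ : unitInterval, 0 < ρ → ρ < 1 →
    Tendsto (fun n => l1Dist (noisedPairLaw μ ρ n) (prodLaw (walkLaw μ n) (walkLaw μ n)))
      atTop (𝓝 0)

end NoiseSensitivity

end

/-! Convolution is multiplication in the group algebra of `G × G` with the `ℓ¹`-norm, so noise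
sensitivity compares the `n`-th powers of two elements. Let `a₁, b₁` and `a₂, b₂` be the involutions
of the two factors, `hᵢ = (aᵢ + bᵢ)/2`, `δᵢ = (aᵢ - bᵢ)/2` and `Δ = δ₁δ₂`. Then `δᵢ` anticommutes
with `hᵢ` and `δᵢ² = 1 - hᵢ²`.

Lazy walk. The noised step is `T_ρ + γΔ`, where `T_ρ` is a polynomial in the commuting `h₁, h₂`, `γ
= 2(1 - ρ)/3`, and `ρ = 1` gives the product step. Binomial cancellation gives `‖δᵢhᵢᵏ‖ =
O(k^(-1/2))` (`norm_halfDiff_mul_pow_le`), hence `1/k` decay of `1 - hᵢ` and of `Δ` against powers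
of the steps. Two elements whose difference carries one such factor on each side have asymptotic
powers: telescoping leaves `∑ 1/((j+1)(n-j)) → 0` (`tendsto_norm_mul_pow_sub`). This applies to `T_ρ
- T_1`, a multiple of `(1 - h₁)(1 - h₂)`. The term `γΔ` has only one factor, but conjugating
approximately by `1 + cΔ` produces the second (`corrector_mul_sub`), thanks to the terms linear in
`hᵢ` that laziness puts in `T_ρ`. For the simple walk the noised step is `h₁h₂ + (1 - ρ)Δ` with `Δ`
commuting with `h₁h₂`, and no such correction exists.

Simple walk. Test the two laws on `σ(xy⁻¹)`, with `σ` a planar representation in which `ba` is a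
rotation by angle `θ`. Both steps have scalar mean, so the means of the `n`-th powers are powers of
scalars (`quotientMap_pow`). With `ρ = 1/2` and `cos θ = 1 - 4/n` they tend to `e⁻¹` and `e⁻²`. -/

noncomputable section

namespace NoiseSensitivity

/-! ### Smoothing estimates in Banach algebras -/

section Smoothing

variable {A : Type*} [NormedRing A] [NormedAlgebra ℝ A] [NormOneClass A]

/-- This is the mean of `C/(k+1)` under a binomial law; `(n+1) * n.choose k = (k+1) * (n+1).choose
(k+1)` turns it into part of a binomial sum of order `n + 1`. -/
theorem sum_choose_mul_div_succ_le {κ C : ℝ} (hκ : 0 < κ) (hκ1 : κ ≤ 1) (hC : 0 ≤ C) (n : ℕ) :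
    ∑ k ∈ Finset.range (n + 1), C / (k + 1) * (κ ^ k * (1 - κ) ^ (n - k) * n.choose k)
      ≤ C / κ / (n + 1) := by
  have key : ∑ k ∈ Finset.range (n + 1), κ ^ (k + 1) * (1 - κ) ^ (n - k) * (n + 1).choose (k + 1)
      ≤ 1 := by
    have h := add_pow κ (1 - κ) (n + 1)
    rw [Finset.sum_range_succ'] at h
    simp only [Nat.add_sub_add_right, add_sub_cancel, one_pow] at h
    have : 0 ≤ κ ^ 0 * (1 - κ) ^ (n + 1 - 0) * ((n + 1).choose 0 : ℝ) := by
      have : 0 ≤ 1 - κ := by linarith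
      positivity
    linarith
  have hterm : ∀ k ∈ Finset.range (n + 1),
      C / (k + 1) * (κ ^ k * (1 - κ) ^ (n - k) * n.choose k)
        = C / κ / (n + 1) * (κ ^ (k + 1) * (1 - κ) ^ (n - k) * (n + 1).choose (k + 1)) := by
    intro k _
    have h : ((n : ℝ) + 1) * n.choose k = (n + 1).choose (k + 1) * (k + 1) := by
      exact_mod_cast Nat.add_one_mul_choose_eq n k
    have h' : ((n + 1).choose (k + 1) : ℝ) = (n + 1) * n.choose k / (k + 1) := by
      field_simp
      linarith
    rw [h']
    field_simp
    ring
  rw [Finset.sum_congr rfl hterm, ← Finset.mul_sum]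
  exact mul_le_of_le_one_right (by positivity) key

/-- If `T` is a mixture, with weight `κ`, of `s` and of a commuting contraction, then
a `1/k` decay of `D * s ^ k` is inherited by `D * T ^ n`. -/
theorem norm_mul_pow_le_of_mixture {s R D T : A} {κ C : ℝ} (hT : T = κ • s + R)
    (hsR : Commute s R) (hκ : 0 < κ) (hκ1 : κ ≤ 1) (hR : ‖R‖ ≤ 1 - κ)
    (hD : ∀ k : ℕ, ‖D * s ^ k‖ ≤ C / (k + 1)) (n : ℕ) :
    ‖D * T ^ n‖ ≤ C / κ / (n + 1) := by
  have hC : 0 ≤ C := by simpa using (norm_nonneg _).trans (hD 0)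
  rw [hT, (hsR.smul_left κ).add_pow, Finset.mul_sum]
  refine (norm_sum_le _ _).trans (le_trans (Finset.sum_le_sum fun k _ => ?_)
    (sum_choose_mul_div_succ_le hκ hκ1 hC n))
  have hfac : D * ((κ • s) ^ k * R ^ (n - k) * (n.choose k : A))
      = (κ ^ k * (n.choose k : ℝ)) • (D * s ^ k * R ^ (n - k)) := by
    rw [smul_pow, ← Nat.smul_one_eq_cast, ← Nat.cast_smul_eq_nsmul ℝ]
    simp only [smul_mul_assoc, mul_smul_comm, mul_one, mul_assoc, smul_smul]
    congr 1
    ring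
  rw [hfac, norm_smul, Real.norm_of_nonneg (by positivity)]
  have hRk : ‖R ^ (n - k)‖ ≤ (1 - κ) ^ (n - k) :=
    (norm_pow_le R _).trans (pow_le_pow_left₀ (norm_nonneg _) hR _)
  calc κ ^ k * (n.choose k : ℝ) * ‖D * s ^ k * R ^ (n - k)‖
      ≤ κ ^ k * (n.choose k : ℝ) * (C / (k + 1) * (1 - κ) ^ (n - k)) := by
        gcongr
        exact (norm_mul_le _ _).trans (mul_le_mul (hD k) hRk (norm_nonneg _) (by positivity))
    _ = _ := by ring

/-- The variance of a fair binomial variable, read off from Bernstein polynomials at `1/2`. -/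
theorem sum_choose_mul_sq (n : ℕ) :
    ∑ j ∈ Finset.range (n + 1), (n.choose j : ℝ) * ((n : ℝ) - 2 * j) ^ 2 = (2 : ℝ) ^ n * (n : ℝ) := by
  have h := congrArg (Polynomial.eval (1 / 2 : ℝ)) (bernsteinPolynomial.variance ℝ n)
  rw [Polynomial.eval_finsetSum] at h
  simp only [bernsteinPolynomial, Polynomial.eval_mul, Polynomial.eval_pow, Polynomial.eval_sub,
    Polynomial.eval_natCast, Polynomial.eval_X, Polynomial.eval_one, nsmul_eq_mul] at h
  have hterm : ∀ j ∈ Finset.range (n + 1), (n.choose j : ℝ) * ((n : ℝ) - 2 * j) ^ 2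
      = 4 * 2 ^ n * (((n : ℝ) * (1 / 2) - j) ^ 2
          * (n.choose j * (1 / 2) ^ j * (1 - 1 / 2) ^ (n - j))) := by
    intro j hj
    have hj' : j ≤ n := Nat.lt_succ_iff.mp (Finset.mem_range.mp hj)
    have hp : (1 / 2 : ℝ) ^ j * (1 - 1 / 2) ^ (n - j) * 2 ^ n = 1 := by
      norm_num
      rw [← pow_add, Nat.add_sub_cancel' hj', ← mul_pow]
      norm_num
    calc (n.choose j : ℝ) * ((n : ℝ) - 2 * j) ^ 2
        = 4 * ((n : ℝ) * (1 / 2) - j) ^ 2 * n.choose j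
            * ((1 / 2 : ℝ) ^ j * (1 - 1 / 2) ^ (n - j) * 2 ^ n) := by rw [hp]; ring
      _ = _ := by ring
  rw [Finset.sum_congr rfl hterm, ← Finset.mul_sum, h]
  ring

theorem sum_choose_mul_abs_le (n : ℕ) :
    ∑ j ∈ Finset.range (n + 1), (n.choose j : ℝ) * |(n : ℝ) - 2 * j| ≤ 2 ^ n * √n := by
  have hcs := Finset.sum_mul_sq_le_sq_mul_sq (Finset.range (n + 1))
    (fun j => √(n.choose j : ℝ)) (fun j => √(n.choose j : ℝ) * |(n : ℝ) - 2 * j|)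
  simp only [mul_pow, Real.sq_sqrt (Nat.cast_nonneg _), sq_abs, ← mul_assoc,
    Real.mul_self_sqrt (Nat.cast_nonneg _)] at hcs
  have h2 : ∑ j ∈ Finset.range (n + 1), (n.choose j : ℝ) = 2 ^ n := by
    exact_mod_cast Nat.sum_range_choose n
  rw [sum_choose_mul_sq, h2] at hcs
  refine le_of_sq_le_sq (hcs.trans (le_of_eq ?_)) (by positivity)
  rw [mul_pow, Real.sq_sqrt (Nat.cast_nonneg _)]
  ring

theorem one_sub_mul_one_add_pow {B : Type*} [Ring B] (t : B) (k : ℕ) :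
    ((k : B) + 1) * ((1 - t) * (1 + t) ^ k)
      = ∑ j ∈ Finset.range (k + 1 + 1), (((k + 1).choose j : ℤ) * ((k : ℤ) + 1 - 2 * j)) • t ^ j := by
  have key : ((k : Polynomial ℤ) + 1) * ((1 - Polynomial.X) * (1 + Polynomial.X) ^ k)
      = ∑ j ∈ Finset.range (k + 1 + 1),
        (((k + 1).choose j : ℤ) * ((k : ℤ) + 1 - 2 * j)) • (Polynomial.X : Polynomial ℤ) ^ j := by
    have h1 : (1 + Polynomial.X : Polynomial ℤ) ^ (k + 1)
        = ∑ j ∈ Finset.range (k + 1 + 1), ((k + 1).choose j : Polynomial ℤ) * Polynomial.X ^ j := by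
      rw [add_comm (1 : Polynomial ℤ), add_pow]
      exact Finset.sum_congr rfl fun j _ => by rw [one_pow, mul_one, mul_comm]
    have h2 := congrArg (fun p => Polynomial.X * Polynomial.derivative p) h1
    simp only [Polynomial.derivative_pow, Polynomial.derivative_add, Polynomial.derivative_one,
      Polynomial.derivative_X, Polynomial.derivative_sum, Polynomial.derivative_mul,
      Polynomial.derivative_natCast, Finset.mul_sum] at h2
    -- Write `1 - X = (1 + X) - 2X`, so that the left side is `(k+1) P - 2X P'` with `P = (1 +
    -- X)^(k+1)`.
    have h3 : ((k : Polynomial ℤ) + 1) * ((1 - Polynomial.X) * (1 + Polynomial.X) ^ k)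
        = ((k : Polynomial ℤ) + 1) * (1 + Polynomial.X) ^ (k + 1)
          - 2 * (Polynomial.X * (Polynomial.C ((k + 1 : ℕ) : ℤ) * (1 + Polynomial.X) ^ (k + 1 - 1)
            * (0 + 1))) := by
      simp only [Nat.add_sub_cancel, map_natCast]
      push_cast
      ring
    rw [h3, h2, h1, Finset.mul_sum, Finset.mul_sum, ← Finset.sum_sub_distrib]
    refine Finset.sum_congr rfl fun j _ => ?_
    rcases j with _ | j
    · simp
    · simp only [zsmul_eq_mul]
      push_cast
      simp
      ring
  have := congrArg (Polynomial.aeval (R := ℤ) t) key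
  simpa [map_sum, map_ofNat] using this

/-- The coefficients are differences of consecutive binomial coefficients; their absolute sum is a
mean absolute deviation, which saves a factor `√k`. -/
theorem norm_one_sub_mul_one_add_pow_le {t : A} (ht : ‖t‖ ≤ 1) (k : ℕ) :
    ‖(1 - t) * (1 + t) ^ k‖ ≤ 2 ^ (k + 1) / √(k + 1) := by
  have h := congrArg norm (one_sub_mul_one_add_pow t k)
  have hk : (0 : ℝ) < (k : ℝ) + 1 := by positivity
  have hl : ((k : A) + 1) * ((1 - t) * (1 + t) ^ k)
      = ((k : ℝ) + 1) • ((1 - t) * (1 + t) ^ k) := by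
    rw [← Nat.cast_add_one, ← nsmul_eq_mul, ← Nat.cast_smul_eq_nsmul ℝ]
    push_cast
    rfl
  rw [hl, norm_smul, Real.norm_of_nonneg hk.le] at h
  have hb : ((k : ℝ) + 1) * ‖(1 - t) * (1 + t) ^ k‖ ≤ 2 ^ (k + 1) * √(k + 1) := by
    rw [h]
    refine (norm_sum_le _ _).trans (le_trans (Finset.sum_le_sum fun j _ => ?_)
      (by simpa using sum_choose_mul_abs_le (k + 1)))
    rw [← Int.cast_smul_eq_zsmul ℝ, norm_smul, Real.norm_eq_abs]
    push_cast
    rw [abs_mul, abs_of_nonneg (Nat.cast_nonneg ((k + 1).choose j) : (0 : ℝ) ≤ _)]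
    exact mul_le_of_le_one_right (by positivity) ((norm_pow_le t j).trans
      (pow_le_one₀ (norm_nonneg _) ht))
  rw [le_div_iff₀ (by positivity)]
  have hs : √((k : ℝ) + 1) * √((k : ℝ) + 1) = (k : ℝ) + 1 := Real.mul_self_sqrt hk.le
  have hs0 : 0 < √((k : ℝ) + 1) := by positivity
  refine le_of_mul_le_mul_right ?_ hs0
  rw [mul_assoc, hs]
  linarith

end Smoothing

/-! ### Pairs of contractive involutions -/

/-- A pair of involutions of norm at most `1`. -/
structure IsInvolutionPair {A : Type*} [NormedRing A] (a b : A) : Prop where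
  norm_left : ‖a‖ ≤ 1
  norm_right : ‖b‖ ≤ 1
  left_mul_self : a * a = 1
  right_mul_self : b * b = 1

namespace IsInvolutionPair

variable {A : Type*} [NormedRing A] {a b : A}

/-- Replaces the noncommutative power by a power in the single contraction `a * b`, up to a
contractive right factor. -/
theorem exists_add_pow_eq [NormOneClass A] (p : IsInvolutionPair a b) (k : ℕ) :
    ∃ u : A, ‖u‖ ≤ 1 ∧ (a + b) ^ k = (1 + a * b) ^ k * u := by
  induction k with
  | zero => exact ⟨1, by simp, by simp⟩
  | succ k ih =>
    obtain ⟨u, hu, hk⟩ := ih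
    have h3 := p.3
    have h4 := p.4
    have hba : (b * a) * (a * b) = 1 := by
      rw [mul_assoc, ← mul_assoc a a b, h3, one_mul, h4]
    have hab : (a * b) * (b * a) = 1 := by
      rw [mul_assoc, ← mul_assoc b b a, h4, one_mul, h3]
    have hconj : SemiconjBy a (1 + a * b) (1 + b * a) := by
      simp only [SemiconjBy, mul_add, add_mul, mul_one, one_mul, ← mul_assoc, h3]
      rw [mul_assoc b, h3, mul_one]
    have hsum : a + b = (1 + b * a) * a := by
      rw [add_mul, mul_assoc, h3, mul_one, one_mul]
    have hfac : 1 + b * a = (b * a) * (1 + a * b) := by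
      rw [mul_add, hba, mul_one, add_comm]
    have hcomm : Commute (b * a) (1 + a * b) := by
      rw [Commute, SemiconjBy, mul_add, add_mul, hba, hab, mul_one, one_mul]
    refine ⟨(b * a) ^ (k + 1) * a * u, ?_, ?_⟩
    · have hn : ‖b * a‖ ≤ 1 :=
        (norm_mul_le _ _).trans (mul_le_one₀ p.2 (norm_nonneg _) p.1)
      have hn' : ‖(b * a) ^ (k + 1)‖ ≤ 1 :=
        (norm_pow_le _ _).trans (pow_le_one₀ (norm_nonneg _) hn)
      exact (norm_mul_le _ _).trans (mul_le_one₀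
        ((norm_mul_le _ _).trans (mul_le_one₀ hn' (norm_nonneg _) p.1)) (norm_nonneg _) hu)
    · calc (a + b) ^ (k + 1) = (1 + b * a) * (a * (1 + a * b) ^ k) * u := by
            rw [pow_succ', hk]
            nth_rewrite 1 [hsum]
            simp only [mul_assoc]
        _ = (1 + b * a) ^ (k + 1) * a * u := by
            rw [(hconj.pow_right k).eq, ← mul_assoc, ← pow_succ']
        _ = _ := by
            rw [hfac, hcomm.mul_pow, ((hcomm.pow_pow _ _)).eq]
            simp only [mul_assoc]

variable [NormedAlgebra ℝ A]

theorem halfSum_mul_halfDiff (p : IsInvolutionPair a b) :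
    ((1 / 2 : ℝ) • (a + b)) * ((1 / 2 : ℝ) • (a - b))
      = -(((1 / 2 : ℝ) • (a - b)) * ((1 / 2 : ℝ) • (a + b))) := by
  simp only [smul_mul_assoc, mul_smul_comm, mul_add, add_mul, mul_sub, sub_mul, p.3, p.4]
  module

theorem halfDiff_mul_self (p : IsInvolutionPair a b) :
    ((1 / 2 : ℝ) • (a - b)) * ((1 / 2 : ℝ) • (a - b))
      = 1 - ((1 / 2 : ℝ) • (a + b)) * ((1 / 2 : ℝ) • (a + b)) := by
  simp only [smul_mul_assoc, mul_smul_comm, mul_add, add_mul, mul_sub, sub_mul, p.3, p.4]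
  module

theorem norm_halfSum_le (p : IsInvolutionPair a b) : ‖(1 / 2 : ℝ) • (a + b)‖ ≤ 1 := by
  rw [norm_smul]
  have := norm_add_le a b
  have h1 := p.1
  have h2 := p.2
  norm_num
  linarith

variable [NormOneClass A]

theorem norm_halfDiff_mul_pow_le (p : IsInvolutionPair a b) (k : ℕ) :
    ‖((1 / 2 : ℝ) • (a - b)) * ((1 / 2 : ℝ) • (a + b)) ^ k‖ ≤ 1 / √(k + 1) := by
  obtain ⟨u, hu, hk⟩ := p.exists_add_pow_eq k
  have hab : ‖a * b‖ ≤ 1 := (norm_mul_le _ _).trans (mul_le_one₀ p.1 (norm_nonneg _) p.2)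
  have hdiff : a - b = a * (1 - a * b) := by
    rw [mul_sub, ← mul_assoc, p.3, mul_one, one_mul]
  have hrw : ((1 / 2 : ℝ) • (a - b)) * ((1 / 2 : ℝ) • (a + b)) ^ k
      = (1 / 2 : ℝ) ^ (k + 1) • (a * ((1 - a * b) * (1 + a * b) ^ k) * u) := by
    rw [smul_pow, hk, smul_mul_smul_comm, ← pow_succ', hdiff]
    simp only [mul_assoc]
  have hn := norm_one_sub_mul_one_add_pow_le hab k
  have hn' : ‖a * ((1 - a * b) * (1 + a * b) ^ k) * u‖ ≤ 2 ^ (k + 1) / √(k + 1) := by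
    calc _ ≤ ‖a * ((1 - a * b) * (1 + a * b) ^ k)‖ :=
          (norm_mul_le _ _).trans (mul_le_of_le_one_right (norm_nonneg _) hu)
      _ ≤ ‖(1 - a * b) * (1 + a * b) ^ k‖ :=
          (norm_mul_le _ _).trans (mul_le_of_le_one_left (norm_nonneg _) p.1)
      _ ≤ _ := hn
  rw [hrw, norm_smul, Real.norm_of_nonneg (by positivity)]
  calc (1 / 2 : ℝ) ^ (k + 1) * ‖a * ((1 - a * b) * (1 + a * b) ^ k) * u‖
      ≤ (1 / 2 : ℝ) ^ (k + 1) * (2 ^ (k + 1) / √(k + 1)) := by gcongr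
    _ = 1 / √(k + 1) := by
        rw [← mul_div_assoc, ← mul_pow]
        norm_num

/-- Since `1 - h² = δ²` and `δ` anticommutes with `h`, one `δ` can be moved to the middle of `h ^
k`; each `δ` then earns a square root from its half. -/
theorem norm_one_sub_sq_mul_pow_le (p : IsInvolutionPair a b) (k : ℕ) :
    ‖(1 - ((1 / 2 : ℝ) • (a + b)) * ((1 / 2 : ℝ) • (a + b))) * ((1 / 2 : ℝ) • (a + b)) ^ k‖
      ≤ 2 / (k + 1) := by
  have hanti := p.halfSum_mul_halfDiff
  have hsq := p.halfDiff_mul_self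
  have hd := p.norm_halfDiff_mul_pow_le
  have hn := p.norm_halfSum_le
  set h := (1 / 2 : ℝ) • (a + b)
  set δ := (1 / 2 : ℝ) • (a - b)
  obtain ⟨m, r, hr, hk⟩ : ∃ m r, r ≤ 1 ∧ k = m + m + r :=
    ⟨k / 2, k % 2, by omega, by omega⟩
  have hfac : (1 - h * h) * h ^ k = δ * (-h) ^ m * (δ * h ^ m) * h ^ r := by
    rw [← hsq, hk, pow_add, pow_add, ← mul_assoc, ← mul_assoc, mul_assoc δ _ (δ * h ^ m),
      ← mul_assoc ((-h) ^ m) δ]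
    have hs : SemiconjBy δ h (-h) := by rw [SemiconjBy, neg_mul, hanti, neg_neg]
    rw [← (hs.pow_right m).eq]
    simp only [mul_assoc]
  have h1 : ‖δ * (-h) ^ m‖ ≤ 1 / √(m + 1) := by
    rw [neg_pow', ← mul_assoc]
    refine (norm_mul_le _ _).trans ((mul_le_of_le_one_right (norm_nonneg _) ?_).trans (hd m))
    exact (norm_pow_le _ _).trans (by simp)
  have h2 : ‖h ^ r‖ ≤ 1 := (norm_pow_le _ _).trans (pow_le_one₀ (norm_nonneg _) hn)
  calc ‖(1 - h * h) * h ^ k‖ ≤ ‖δ * (-h) ^ m * (δ * h ^ m)‖ := by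
        rw [hfac]
        exact (norm_mul_le _ _).trans (mul_le_of_le_one_right (norm_nonneg _) h2)
    _ ≤ 1 / √(m + 1) * (1 / √(m + 1)) :=
        (norm_mul_le _ _).trans (mul_le_mul h1 (hd m) (norm_nonneg _) (by positivity))
    _ = 1 / (m + 1) := by
        rw [div_mul_div_comm, Real.mul_self_sqrt (by positivity), one_mul]
    _ ≤ 2 / (k + 1) := by
        have hr' : (r : ℝ) ≤ 1 := by exact_mod_cast hr
        rw [hk, div_le_div_iff₀ (by positivity) (by positivity)]
        push_cast
        linarith

/-- The preceding bound needs `1 - h²`; one lazy factor supplies the missing `1 + h`. -/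
theorem norm_one_sub_mul_lazy_pow_le (p : IsInvolutionPair a b) (k : ℕ) :
    ‖(1 - (1 / 2 : ℝ) • (a + b)) * ((1 / 2 : ℝ) • (1 + (1 / 2 : ℝ) • (a + b))) ^ k‖
      ≤ 4 / (k + 1) := by
  have hsq := p.norm_one_sub_sq_mul_pow_le
  have hn := p.norm_halfSum_le
  set h := (1 / 2 : ℝ) • (a + b)
  have hlazy := norm_mul_pow_le_of_mixture (s := h) (R := (1 / 2 : ℝ) • (1 : A))
    (D := 1 - h * h) (T := (1 / 2 : ℝ) • (1 + h)) (κ := 1 / 2) (C := 2)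
    (by rw [smul_add, add_comm]) ((Commute.one_right h).smul_right _) (by norm_num) (by norm_num)
    (by rw [norm_smul]; norm_num) hsq
  rcases k with _ | k
  · refine le_trans ?_ (show (2 : ℝ) ≤ _ by norm_num)
    rw [pow_zero, mul_one]
    refine (norm_sub_le _ _).trans ?_
    rw [norm_one]
    linarith
  · have hfac : (1 - h) * ((1 / 2 : ℝ) • (1 + h)) ^ (k + 1)
        = (1 / 2 : ℝ) • ((1 - h * h) * ((1 / 2 : ℝ) • (1 + h)) ^ k) := by
      rw [pow_succ', ← mul_assoc, mul_smul_comm, smul_mul_assoc]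
      congr 2
      noncomm_ring
    rw [hfac, norm_smul, Real.norm_of_nonneg (by norm_num)]
    calc (1 / 2 : ℝ) * ‖(1 - h * h) * ((1 / 2 : ℝ) • (1 + h)) ^ k‖
        ≤ 1 / 2 * (2 / (1 / 2) / (k + 1)) := by gcongr; exact hlazy k
      _ ≤ _ := by
        push_cast
        rw [show (1 / 2 * (2 / (1 / 2) / ((k : ℝ) + 1))) = 2 / (k + 1) by ring,
          div_le_div_iff₀ (by positivity) (by positivity)]
        linarith

end IsInvolutionPair

/-! ### Comparison of powers -/

/-- Telescoping of `Y ^ j * V * X ^ (n - j)`; nothing needs to commute. -/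
theorem mul_pow_sub_pow_mul {R : Type*} [Ring R] (V X Y : R) (n : ℕ) :
    V * X ^ n - Y ^ n * V
      = ∑ j ∈ Finset.range n, Y ^ j * (V * X - Y * V) * X ^ (n - 1 - j) := by
  induction n with
  | zero => simp
  | succ n ih =>
    have hstep : V * X ^ (n + 1) - Y ^ (n + 1) * V
        = (V * X ^ n - Y ^ n * V) * X + Y ^ n * (V * X - Y * V) := by
      rw [pow_succ, pow_succ]
      noncomm_ring
    rw [hstep, ih, Finset.sum_range_succ, Finset.sum_mul]
    congr 1
    · refine Finset.sum_congr rfl fun j hj => ?_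
      have hj' := Finset.mem_range.mp hj
      rw [mul_assoc _ _ X, ← pow_succ]
      congr 2
      omega
    · simp

theorem tendsto_sum_inv_mul_inv (C : ℝ) :
    Tendsto (fun n : ℕ => ∑ j ∈ Finset.range n, C / ((j + 1) * ((n - 1 - j : ℕ) + 1)))
      atTop (𝓝 0) := by
  have hces : Tendsto (fun n : ℕ => (2 * C) * ((n + 1 : ℕ) : ℝ)⁻¹
      * ∑ j ∈ Finset.range n, 1 / ((j : ℝ) + 1)) atTop (𝓝 0) := by
    have h := (tendsto_one_div_add_atTop_nhds_zero_nat (𝕜 := ℝ)).cesaro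
    have h' : Tendsto (fun n : ℕ => (n : ℝ) / (n + 1)) atTop (𝓝 1) :=
      tendsto_natCast_div_add_atTop 1
    have := (h'.mul h).const_mul (2 * C)
    simp only [mul_zero] at this
    refine this.congr' ?_
    filter_upwards [eventually_gt_atTop 0] with n hn
    have : (0 : ℝ) < n := by exact_mod_cast hn
    push_cast
    field_simp
  refine hces.congr fun n => ?_
  -- Partial fractions, as the two factors add up to `n + 1`; what remains is a Cesàro mean of
  -- `1/(j+1)`.
  have hsplit : ∀ j ∈ Finset.range n, C / (((j : ℝ) + 1) * ((n - 1 - j : ℕ) + 1))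
      = C * ((n + 1 : ℕ) : ℝ)⁻¹ * (1 / (j + 1) + 1 / ((n - 1 - j : ℕ) + 1)) := by
    intro j hj
    have hj' := Finset.mem_range.mp hj
    have hsum : ((n + 1 : ℕ) : ℝ) = (j + 1) + ((n - 1 - j : ℕ) + 1) := by
      exact_mod_cast (by omega : n + 1 = (j + 1) + ((n - 1 - j) + 1))
    rw [hsum]
    field_simp
    ring
  rw [Finset.sum_congr rfl hsplit, ← Finset.mul_sum, Finset.sum_add_distrib,
    Finset.sum_range_reflect (fun j : ℕ => 1 / ((j : ℝ) + 1)) n]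
  ring

theorem tendsto_norm_mul_pow_sub {A : Type*} [NormedRing A] {V X Y : A} {C : ℝ}
    (h : ∀ j l : ℕ, ‖Y ^ j * (V * X - Y * V) * X ^ l‖ ≤ C / ((j + 1) * (l + 1))) :
    Tendsto (fun n => ‖V * X ^ n - Y ^ n * V‖) atTop (𝓝 0) := by
  refine squeeze_zero (fun _ => norm_nonneg _) (fun n => ?_) (tendsto_sum_inv_mul_inv C)
  rw [mul_pow_sub_pow_mul]
  exact (norm_sum_le _ _).trans (Finset.sum_le_sum fun j _ => h j _)

/-! ### Two commuting pairs of involutions -/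

section Algebraic

variable {A : Type*} [Ring A] [Algebra ℝ A]

/-- The polynomial `(1 - ρ) (1 + 2 h₁ h₂) / 3 + ρ (1 + 2 h₁) (1 + 2 h₂) / 9`. -/
def lazyMixture (ρ : ℝ) (h₁ h₂ : A) : A :=
  ((1 - ρ) / 3) • (1 + (2 : ℝ) • (h₁ * h₂))
    + (ρ / 9) • ((1 + (2 : ℝ) • h₁) * (1 + (2 : ℝ) • h₂))

theorem lazyMixture_eq (ρ : ℝ) (h₁ h₂ : A) :
    lazyMixture ρ h₁ h₂ = (2 / 3 - 2 * ρ / 9 : ℝ) • (h₁ * h₂) + (1 / 3 - 2 * ρ / 9 : ℝ) • 1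
      + (2 * ρ / 9) • (h₁ + h₂) := by
  simp only [lazyMixture, mul_add, add_mul, mul_one, one_mul, smul_mul_assoc, mul_smul_comm]
  module

theorem lazyMixture_comm (ρ : ℝ) {h₁ h₂ : A} (h : Commute h₁ h₂) :
    lazyMixture ρ h₂ h₁ = lazyMixture ρ h₁ h₂ := by
  rw [lazyMixture_eq, lazyMixture_eq, h.eq, add_comm h₁]

theorem commute_lazyMixture (ρ : ℝ) {h₁ h₂ x : A} (h₁x : Commute x h₁) (h₂x : Commute x h₂) :
    Commute x (lazyMixture ρ h₁ h₂) := by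
  rw [lazyMixture_eq]
  exact (((h₁x.mul_right h₂x).smul_right _).add_right ((Commute.one_right x).smul_right _)).add_right
    ((h₁x.add_right h₂x).smul_right _)

theorem lazyMixture_sub_lazyMixture_one (ρ : ℝ) (h₁ h₂ : A) :
    lazyMixture ρ h₁ h₂ - lazyMixture 1 h₁ h₂ = (2 * (1 - ρ) / 9) • ((1 - h₁) * (1 - h₂)) := by
  simp only [lazyMixture_eq, mul_sub, sub_mul, mul_one, one_mul]
  module

theorem semiconjBy_lazyMixture (ρ : ℝ) {h₁ h₂ Δ : A} (h₁Δ : h₁ * Δ = -(Δ * h₁))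
    (h₂Δ : h₂ * Δ = -(Δ * h₂)) :
    SemiconjBy Δ (lazyMixture ρ (-h₁) (-h₂)) (lazyMixture ρ h₁ h₂) := by
  have h : h₁ * h₂ * Δ = Δ * (h₁ * h₂) := by
    rw [mul_assoc, h₂Δ, mul_neg, ← mul_assoc, h₁Δ, neg_mul, neg_neg, mul_assoc]
  simp only [SemiconjBy, lazyMixture_eq, mul_add, add_mul, smul_mul_assoc, mul_smul_comm, mul_one,
    one_mul, h, h₁Δ, h₂Δ, mul_neg, neg_mul, neg_neg]

/-- The element `1 + c Δ` almost intertwines `lazyMixture ρ h₁ h₂ + γ Δ` and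
`lazyMixture ρ h₁ h₂`. -/
theorem corrector_mul_sub (ρ c : ℝ) {h₁ h₂ Δ : A} (h₁Δ : h₁ * Δ = -(Δ * h₁))
    (h₂Δ : h₂ * Δ = -(Δ * h₂)) :
    (1 + c • Δ) * (lazyMixture ρ h₁ h₂ + (8 * c * ρ / 9) • Δ) - lazyMixture ρ h₁ h₂ * (1 + c • Δ)
      = (4 * c * ρ / 9) • (((1 - h₁) + (1 - h₂)) * Δ) + (c * (8 * c * ρ / 9)) • (Δ * Δ) := by
  have h : Δ * (h₁ * h₂) = h₁ * h₂ * Δ := by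
    rw [mul_assoc h₁, h₂Δ, mul_neg, ← mul_assoc h₁, h₁Δ, neg_mul, neg_neg, mul_assoc]
  have h1 : Δ * h₁ = -(h₁ * Δ) := by rw [h₁Δ, neg_neg]
  have h2 : Δ * h₂ = -(h₂ * Δ) := by rw [h₂Δ, neg_neg]
  simp only [lazyMixture_eq, mul_add, add_mul, sub_mul, smul_mul_assoc, mul_smul_comm, mul_one,
    one_mul, h, h1, h2]
  module

end Algebraic

section TwoPairs

variable {A : Type*} [NormedRing A] [NormedAlgebra ℝ A] [NormOneClass A] {a₁ b₁ a₂ b₂ : A}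

theorem norm_one_sub_mul_lazyMixture_pow_le {h₁ h₂ : A} (hn₁ : ‖h₁‖ ≤ 1) (hn₂ : ‖h₂‖ ≤ 1)
    (hc : Commute h₁ h₂)
    (hlazy : ∀ k : ℕ, ‖(1 - h₁) * ((1 / 2 : ℝ) • (1 + h₁)) ^ k‖ ≤ 4 / (k + 1))
    {ρ : ℝ} (hρ : 0 < ρ) (hρ1 : ρ ≤ 1) (n : ℕ) :
    ‖(1 - h₁) * lazyMixture ρ h₁ h₂ ^ n‖ ≤ 18 / ρ / (n + 1) := by
  have hn : ‖h₁ * h₂‖ ≤ 1 := (norm_mul_le _ _).trans (mul_le_one₀ hn₁ (norm_nonneg _) hn₂)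
  have hcomm : Commute h₁ (((1 - ρ) / 3) • (1 + (2 : ℝ) • (h₁ * h₂))
      + (ρ / 9) • (h₁ + (2 : ℝ) • h₂ + (4 : ℝ) • (h₁ * h₂))) := by
    have h12 : Commute h₁ (h₁ * h₂) := (Commute.refl h₁).mul_right hc
    exact (((Commute.one_right _).add_right (h12.smul_right _)).smul_right _).add_right
      ((((Commute.refl h₁).add_right (hc.smul_right _)).add_right (h12.smul_right _)).smul_right _)
  -- The piece split off is `(ρ/9)(1 + h₁)`, found in the refreshed part; the other coefficients add
  -- up to `1 - 2ρ/9`.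
  have h := norm_mul_pow_le_of_mixture (s := (1 / 2 : ℝ) • (1 + h₁))
    (R := ((1 - ρ) / 3) • (1 + (2 : ℝ) • (h₁ * h₂))
      + (ρ / 9) • (h₁ + (2 : ℝ) • h₂ + (4 : ℝ) • (h₁ * h₂)))
    (D := 1 - h₁) (T := lazyMixture ρ h₁ h₂) (κ := 2 * ρ / 9) (C := 4)
    (by rw [lazyMixture_eq]; module)
    (((Commute.one_left _).add_left hcomm).smul_left _) (by positivity) (by linarith) ?_ hlazy n
  · refine h.trans (le_of_eq ?_)
    field_simp
    norm_num
  · have e1 : ‖((1 - ρ) / 3) • (1 + (2 : ℝ) • (h₁ * h₂))‖ ≤ (1 - ρ) / 3 * (1 + 2 * 1) := by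
      rw [norm_smul, Real.norm_of_nonneg (by linarith)]
      refine mul_le_mul_of_nonneg_left ((norm_add_le _ _).trans ?_) (by linarith)
      rw [norm_one, norm_smul, Real.norm_of_nonneg (by norm_num)]
      linarith
    have e2 : ‖(ρ / 9) • (h₁ + (2 : ℝ) • h₂ + (4 : ℝ) • (h₁ * h₂))‖
        ≤ ρ / 9 * (1 + 2 * 1 + 4 * 1) := by
      rw [norm_smul, Real.norm_of_nonneg (by positivity)]
      refine mul_le_mul_of_nonneg_left ((norm_add₃_le).trans ?_) (by positivity)
      rw [norm_smul, norm_smul, Real.norm_of_nonneg (by norm_num),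
        Real.norm_of_nonneg (by norm_num)]
      linarith
    refine (norm_add_le _ _).trans ((add_le_add e1 e2).trans (le_of_eq ?_))
    ring

theorem tendsto_lazyMixture_pow_sub {h₁ h₂ : A} (hn₁ : ‖h₁‖ ≤ 1) (hn₂ : ‖h₂‖ ≤ 1)
    (hc : Commute h₁ h₂)
    (hlazy₁ : ∀ k : ℕ, ‖(1 - h₁) * ((1 / 2 : ℝ) • (1 + h₁)) ^ k‖ ≤ 4 / (k + 1))
    (hlazy₂ : ∀ k : ℕ, ‖(1 - h₂) * ((1 / 2 : ℝ) • (1 + h₂)) ^ k‖ ≤ 4 / (k + 1))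
    {ρ : ℝ} (hρ : 0 < ρ) (hρ1 : ρ ≤ 1) :
    Tendsto (fun n => ‖lazyMixture ρ h₁ h₂ ^ n - lazyMixture 1 h₁ h₂ ^ n‖) atTop (𝓝 0) := by
  have h := tendsto_norm_mul_pow_sub (V := (1 : A)) (X := lazyMixture ρ h₁ h₂)
    (Y := lazyMixture 1 h₁ h₂) (C := 2 * (1 - ρ) / 9 * (18 * (18 / ρ))) ?_
  · simpa using h
  intro j l
  have hcomm : Commute (1 - h₁) (lazyMixture 1 h₁ h₂) :=
    commute_lazyMixture 1 ((Commute.one_left _).sub_left (Commute.refl _))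
      ((Commute.one_left _).sub_left hc)
  have hrw : lazyMixture 1 h₁ h₂ ^ j * (1 * lazyMixture ρ h₁ h₂ - lazyMixture 1 h₁ h₂ * 1)
        * lazyMixture ρ h₁ h₂ ^ l
      = (2 * (1 - ρ) / 9) • (((1 - h₁) * lazyMixture 1 h₁ h₂ ^ j)
        * ((1 - h₂) * lazyMixture ρ h₁ h₂ ^ l)) := by
    rw [one_mul, mul_one, lazyMixture_sub_lazyMixture_one, mul_smul_comm, smul_mul_assoc,
      ← mul_assoc, ← (hcomm.pow_right j).eq]
    simp only [mul_assoc]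
  have e1 := norm_one_sub_mul_lazyMixture_pow_le hn₁ hn₂ hc hlazy₁ one_pos le_rfl j
  have e2 := norm_one_sub_mul_lazyMixture_pow_le hn₂ hn₁ hc.symm hlazy₂ hρ hρ1 l
  rw [lazyMixture_comm ρ hc] at e2
  rw [hrw, norm_smul, Real.norm_of_nonneg (by linarith)]
  refine (mul_le_mul_of_nonneg_left ((norm_mul_le _ _).trans
    (mul_le_mul e1 e2 (norm_nonneg _) (by positivity))) (by linarith)).trans (le_of_eq ?_)
  field_simp

/-- A mixture containing the product `h₁ * h₂` decays against the product of the half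
differences of the two pairs. -/
theorem norm_halfDiff_mul_halfDiff_mul_pow_le (p : IsInvolutionPair a₁ b₁)
    (q : IsInvolutionPair a₂ b₂)
    (hc : Commute ((1 / 2 : ℝ) • (a₁ + b₁)) ((1 / 2 : ℝ) • (a₂ + b₂)))
    (hc' : Commute ((1 / 2 : ℝ) • (a₂ - b₂)) ((1 / 2 : ℝ) • (a₁ + b₁))) (k : ℕ) :
    ‖((1 / 2 : ℝ) • (a₁ - b₁)) * ((1 / 2 : ℝ) • (a₂ - b₂))
      * (((1 / 2 : ℝ) • (a₁ + b₁)) * ((1 / 2 : ℝ) • (a₂ + b₂))) ^ k‖ ≤ 1 / (k + 1) := by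
  have e1 := p.norm_halfDiff_mul_pow_le k
  have e2 := q.norm_halfDiff_mul_pow_le k
  rw [hc.mul_pow, mul_assoc, ← mul_assoc _ _ (_ ^ k), (hc'.pow_right k).eq, mul_assoc (_ ^ k),
    ← mul_assoc]
  refine (norm_mul_le _ _).trans ((mul_le_mul e1 e2 (norm_nonneg _) (by positivity)).trans
    (le_of_eq ?_))
  rw [div_mul_div_comm, Real.mul_self_sqrt (by positivity), one_mul]

/-- The refreshed part contains `h₁ * h₂` with weight `4ρ/9`. The free term `D` serves both steps to
be compared: `D = Δ` for the perturbed one, `D = 0` for the unperturbed one. -/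
theorem norm_mul_lazyMixture_pow_le {h₁ h₂ Δ : A} (hn₁ : ‖h₁‖ ≤ 1) (hn₂ : ‖h₂‖ ≤ 1)
    (hc : Commute h₁ h₂) (hΔ : ∀ k : ℕ, ‖Δ * (h₁ * h₂) ^ k‖ ≤ 1 / (k + 1))
    {ρ : ℝ} (hρ : 0 < ρ) (hρ1 : ρ ≤ 1) {D : A} (hD : ‖h₁ * h₂ + D‖ ≤ 1)
    (hcD : Commute (h₁ * h₂) D) (n : ℕ) :
    ‖Δ * (lazyMixture ρ h₁ h₂ + (2 * (1 - ρ) / 3) • D) ^ n‖ ≤ 9 / (4 * ρ) / (n + 1) := by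
  have h12₁ : Commute (h₁ * h₂) h₁ := (Commute.refl h₁).mul_left hc.symm
  have h12₂ : Commute (h₁ * h₂) h₂ := hc.mul_left (Commute.refl h₂)
  have h := norm_mul_pow_le_of_mixture (s := h₁ * h₂)
    (R := ((1 - ρ) / 3) • (1 + (2 : ℝ) • (h₁ * h₂ + D))
      + (ρ / 9) • (1 + (2 : ℝ) • h₁ + (2 : ℝ) • h₂))
    (D := Δ) (T := lazyMixture ρ h₁ h₂ + (2 * (1 - ρ) / 3) • D) (κ := 4 * ρ / 9) (C := 1)
    (by rw [lazyMixture_eq]; module)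
    ((((Commute.one_right _).add_right
      (((Commute.refl (h₁ * h₂)).add_right hcD).smul_right _)).smul_right _).add_right
      ((((Commute.one_right _).add_right (h12₁.smul_right _)).add_right
        (h12₂.smul_right _)).smul_right _))
    (by positivity) (by linarith) ?_ hΔ n
  · refine h.trans (le_of_eq ?_)
    field_simp
  · have e1 : ‖((1 - ρ) / 3) • (1 + (2 : ℝ) • (h₁ * h₂ + D))‖ ≤ (1 - ρ) / 3 * (1 + 2 * 1) := by
      rw [norm_smul, Real.norm_of_nonneg (by linarith)]
      refine mul_le_mul_of_nonneg_left ((norm_add_le _ _).trans ?_) (by linarith)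
      rw [norm_one, norm_smul, Real.norm_of_nonneg (by norm_num)]
      linarith
    have e2 : ‖(ρ / 9) • (1 + (2 : ℝ) • h₁ + (2 : ℝ) • h₂)‖ ≤ ρ / 9 * (1 + 2 * 1 + 2 * 1) := by
      rw [norm_smul, Real.norm_of_nonneg (by positivity)]
      refine mul_le_mul_of_nonneg_left ((norm_add₃_le).trans ?_) (by positivity)
      rw [norm_one, norm_smul, norm_smul, Real.norm_of_nonneg (by norm_num)]
      linarith
    refine (norm_add_le _ _).trans ((add_le_add e1 e2).trans (le_of_eq ?_))
    ring

theorem tendsto_perturbed_lazyMixture_pow_sub {h₁ h₂ Δ : A} (hn₁ : ‖h₁‖ ≤ 1) (hn₂ : ‖h₂‖ ≤ 1)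
    (hc : Commute h₁ h₂)
    (hlazy₁ : ∀ k : ℕ, ‖(1 - h₁) * ((1 / 2 : ℝ) • (1 + h₁)) ^ k‖ ≤ 4 / (k + 1))
    (hlazy₂ : ∀ k : ℕ, ‖(1 - h₂) * ((1 / 2 : ℝ) • (1 + h₂)) ^ k‖ ≤ 4 / (k + 1))
    (hΔ : ∀ k : ℕ, ‖Δ * (h₁ * h₂) ^ k‖ ≤ 1 / (k + 1))
    (h₁Δ : h₁ * Δ = -(Δ * h₁)) (h₂Δ : h₂ * Δ = -(Δ * h₂)) (hD : ‖h₁ * h₂ + Δ‖ ≤ 1)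
    {ρ : ℝ} (hρ : 0 < ρ) (hρ1 : ρ ≤ 1) :
    Tendsto (fun n => ‖(lazyMixture ρ h₁ h₂ + (2 * (1 - ρ) / 3) • Δ) ^ n
      - lazyMixture ρ h₁ h₂ ^ n‖) atTop (𝓝 0) := by
  have hcΔ : Commute (h₁ * h₂) Δ := by
    rw [Commute, SemiconjBy, mul_assoc, h₂Δ, mul_neg, ← mul_assoc, h₁Δ, neg_mul, neg_neg, mul_assoc]
  have hX := norm_mul_lazyMixture_pow_le hn₁ hn₂ hc hΔ hρ hρ1 hD hcΔ
  have hn : ‖h₁ * h₂‖ ≤ 1 := (norm_mul_le _ _).trans (mul_le_one₀ hn₁ (norm_nonneg _) hn₂)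
  have hY : ∀ n : ℕ, ‖lazyMixture ρ h₁ h₂ ^ n * Δ‖ ≤ 9 / (4 * ρ) / (n + 1) := by
    intro n
    rw [← ((semiconjBy_lazyMixture ρ h₁Δ h₂Δ).pow_right n).eq]
    -- Moving `Δ` to the left flips the signs of `h₁` and `h₂` but not of their product.
    have h := norm_mul_lazyMixture_pow_le (h₁ := -h₁) (h₂ := -h₂) (Δ := Δ) (D := 0)
      (by rwa [norm_neg]) (by rwa [norm_neg]) (hc.neg_left.neg_right)
      (by simpa only [neg_mul_neg] using hΔ) hρ hρ1 (by simpa using hn) (Commute.zero_right _) n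
    simpa using h
  set γ : ℝ := 2 * (1 - ρ) / 3 with hγ
  have hγ0 : 0 ≤ γ := by rw [hγ]; linarith
  -- Chosen so that the commutator of `c • Δ` with `T` cancels `γ • Δ` when `h₁` and `h₂` are
  -- replaced by `1`.
  set c : ℝ := 9 * γ / (8 * ρ) with hcdef
  have hc0 : 0 ≤ c := by positivity
  have hcγ : 8 * c * ρ / 9 = γ := by rw [hcdef]; field_simp
  have hE := corrector_mul_sub ρ c h₁Δ h₂Δ
  rw [hcγ] at hE
  have hE' : 4 * c * ρ / 9 = γ / 2 := by linarith
  rw [hE'] at hE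
  set T := lazyMixture ρ h₁ h₂ with hTdef
  set X := T + γ • Δ
  have hW₁ : ∀ j : ℕ, ‖T ^ j * (1 - h₁)‖ ≤ 18 / ρ / (j + 1) := by
    intro j
    have hcomm : Commute (1 - h₁) T :=
      commute_lazyMixture ρ ((Commute.one_left _).sub_left (Commute.refl _))
        ((Commute.one_left _).sub_left hc)
    rw [← (hcomm.pow_right j).eq]
    exact norm_one_sub_mul_lazyMixture_pow_le hn₁ hn₂ hc hlazy₁ hρ hρ1 j
  have hW₂ : ∀ j : ℕ, ‖T ^ j * (1 - h₂)‖ ≤ 18 / ρ / (j + 1) := by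
    intro j
    have hcomm : Commute (1 - h₂) T :=
      commute_lazyMixture ρ ((Commute.one_left _).sub_left hc.symm)
        ((Commute.one_left _).sub_left (Commute.refl _))
    rw [← (hcomm.pow_right j).eq, hTdef, ← lazyMixture_comm ρ hc]
    exact norm_one_sub_mul_lazyMixture_pow_le hn₂ hn₁ hc.symm hlazy₂ hρ hρ1 j
  have hmain := tendsto_norm_mul_pow_sub (V := 1 + c • Δ) (X := X) (Y := T)
    (C := (γ / 2 * (18 / ρ + 18 / ρ) + c * γ * (9 / (4 * ρ))) * (9 / (4 * ρ))) (by
      intro j l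
      have hrw : T ^ j * ((1 + c • Δ) * X - T * (1 + c • Δ)) * X ^ l
          = ((γ / 2) • (T ^ j * (1 - h₁) + T ^ j * (1 - h₂)) + (c * γ) • (T ^ j * Δ))
            * (Δ * X ^ l) := by
        rw [hE]
        simp only [mul_add, add_mul, smul_mul_assoc, mul_smul_comm, mul_assoc]
      have hl : ‖(γ / 2) • (T ^ j * (1 - h₁) + T ^ j * (1 - h₂)) + (c * γ) • (T ^ j * Δ)‖
          ≤ γ / 2 * (18 / ρ / (j + 1) + 18 / ρ / (j + 1)) + c * γ * (9 / (4 * ρ) / (j + 1)) := by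
        refine (norm_add_le _ _).trans ?_
        rw [norm_smul, norm_smul, Real.norm_of_nonneg (by positivity),
          Real.norm_of_nonneg (by positivity)]
        gcongr
        · exact (norm_add_le _ _).trans (add_le_add (hW₁ j) (hW₂ j))
        · exact hY j
      rw [hrw]
      refine (norm_mul_le _ _).trans ((mul_le_mul hl (hX l) (norm_nonneg _)
        (by positivity)).trans (le_of_eq ?_))
      field_simp)
  have hdecay : Tendsto (fun n : ℕ => 2 * (c * (9 / (4 * ρ) / ((n : ℝ) + 1)))) atTop (𝓝 0) := by
    have := (tendsto_one_div_add_atTop_nhds_zero_nat (𝕜 := ℝ)).const_mul (2 * (c * (9 / (4 * ρ))))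
    rw [mul_zero] at this
    refine this.congr fun n => by ring
  refine squeeze_zero (fun _ => norm_nonneg _) (fun n => ?_)
    (by simpa using hmain.add hdecay)
  -- Removing the corrector costs only `T ^ n * Δ` and `Δ * X ^ n`, both of order `1/n`.
  have hsplit : X ^ n - T ^ n = ((1 + c • Δ) * X ^ n - T ^ n * (1 + c • Δ))
      + (c • (T ^ n * Δ) - c • (Δ * X ^ n)) := by
    simp only [mul_add, add_mul, smul_mul_assoc, mul_smul_comm, mul_one, one_mul]
    abel
  rw [hsplit]
  refine (norm_add_le _ _).trans (add_le_add le_rfl ((norm_sub_le _ _).trans ?_))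
  rw [norm_smul, norm_smul, Real.norm_of_nonneg hc0, two_mul]
  exact add_le_add (mul_le_mul_of_nonneg_left (hY n) hc0) (mul_le_mul_of_nonneg_left (hX n) hc0)

/-- The powers of the noised step are asymptotic to those of the product step. -/
theorem tendsto_noised_pow_sub (p : IsInvolutionPair a₁ b₁) (q : IsInvolutionPair a₂ b₂)
    (haa : Commute a₁ a₂) (hab : Commute a₁ b₂) (hba : Commute b₁ a₂) (hbb : Commute b₁ b₂)
    {ρ : ℝ} (hρ : 0 < ρ) (hρ1 : ρ ≤ 1) :
    Tendsto (fun n => ‖((1 - ρ) • ((1 / 3 : ℝ) • (a₁ * a₂ + b₁ * b₂ + 1))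
        + ρ • (((1 / 3 : ℝ) • (a₁ + b₁ + 1)) * ((1 / 3 : ℝ) • (a₂ + b₂ + 1)))) ^ n
      - (((1 / 3 : ℝ) • (a₁ + b₁ + 1)) * ((1 / 3 : ℝ) • (a₂ + b₂ + 1))) ^ n‖) atTop (𝓝 0) := by
  have hlazy₁ := p.norm_one_sub_mul_lazy_pow_le
  have hlazy₂ := q.norm_one_sub_mul_lazy_pow_le
  have hn₁ := p.norm_halfSum_le
  have hn₂ := q.norm_halfSum_le
  have hanti₁ := p.halfSum_mul_halfDiff
  have hanti₂ := q.halfSum_mul_halfDiff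
  have hsum : Commute (a₁ + b₁) (a₂ + b₂) :=
    (haa.add_right hab).add_left (hba.add_right hbb)
  have hc : Commute ((1 / 2 : ℝ) • (a₁ + b₁)) ((1 / 2 : ℝ) • (a₂ + b₂)) :=
    (hsum.smul_left _).smul_right _
  have hc₂₁ : Commute ((1 / 2 : ℝ) • (a₂ - b₂)) ((1 / 2 : ℝ) • (a₁ + b₁)) :=
    (((haa.symm.add_right hba.symm).sub_left (hab.symm.add_right hbb.symm)).smul_left _).smul_right _
  have hc₁₂ : Commute ((1 / 2 : ℝ) • (a₁ - b₁)) ((1 / 2 : ℝ) • (a₂ + b₂)) :=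
    (((haa.add_right hab).sub_left (hba.add_right hbb)).smul_left _).smul_right _
  have hΔ := norm_halfDiff_mul_halfDiff_mul_pow_le p q hc hc₂₁
  have hprod : ((1 / 2 : ℝ) • (a₁ + b₁)) * ((1 / 2 : ℝ) • (a₂ + b₂))
      + ((1 / 2 : ℝ) • (a₁ - b₁)) * ((1 / 2 : ℝ) • (a₂ - b₂))
      = (1 / 2 : ℝ) • (a₁ * a₂ + b₁ * b₂) := by
    simp only [smul_mul_assoc, mul_smul_comm, mul_add, add_mul, mul_sub, sub_mul]
    module
  have hD : ‖((1 / 2 : ℝ) • (a₁ + b₁)) * ((1 / 2 : ℝ) • (a₂ + b₂))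
      + ((1 / 2 : ℝ) • (a₁ - b₁)) * ((1 / 2 : ℝ) • (a₂ - b₂))‖ ≤ 1 := by
    have e1 : ‖a₁ * a₂‖ ≤ 1 := (norm_mul_le _ _).trans (mul_le_one₀ p.1 (norm_nonneg _) q.1)
    have e2 : ‖b₁ * b₂‖ ≤ 1 := (norm_mul_le _ _).trans (mul_le_one₀ p.2 (norm_nonneg _) q.2)
    have e3 := norm_add_le (a₁ * a₂) (b₁ * b₂)
    rw [hprod, norm_smul, Real.norm_of_nonneg (by norm_num)]
    linarith
  -- Stated for all `r` because `r = 1` identifies the product step, where the `δ₁δ₂` term drops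
  -- out.
  have hstep : ∀ r : ℝ, (1 - r) • ((1 / 3 : ℝ) • (a₁ * a₂ + b₁ * b₂ + 1))
        + r • (((1 / 3 : ℝ) • (a₁ + b₁ + 1)) * ((1 / 3 : ℝ) • (a₂ + b₂ + 1)))
      = lazyMixture r ((1 / 2 : ℝ) • (a₁ + b₁)) ((1 / 2 : ℝ) • (a₂ + b₂))
        + (2 * (1 - r) / 3) • (((1 / 2 : ℝ) • (a₁ - b₁)) * ((1 / 2 : ℝ) • (a₂ - b₂))) := by
    intro r
    simp only [lazyMixture_eq, smul_mul_assoc, mul_smul_comm, mul_add, add_mul, mul_sub, sub_mul,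
      one_mul, mul_one]
    module
  have hstep1 := hstep 1
  simp only [sub_self, zero_smul, zero_add, one_smul, mul_zero, zero_div, add_zero] at hstep1
  rw [hstep ρ, hstep1]
  set h₁ := (1 / 2 : ℝ) • (a₁ + b₁)
  set h₂ := (1 / 2 : ℝ) • (a₂ + b₂)
  set δ₁ := (1 / 2 : ℝ) • (a₁ - b₁)
  set δ₂ := (1 / 2 : ℝ) • (a₂ - b₂)
  have h₁Δ : h₁ * (δ₁ * δ₂) = -(δ₁ * δ₂ * h₁) := by
    rw [← mul_assoc, hanti₁, neg_mul, mul_assoc δ₁ δ₂, hc₂₁.eq, mul_assoc]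
  have h₂Δ : h₂ * (δ₁ * δ₂) = -(δ₁ * δ₂ * h₂) := by
    rw [← mul_assoc, ← hc₁₂.eq, mul_assoc, hanti₂, mul_neg, mul_assoc]
  have t1 := tendsto_perturbed_lazyMixture_pow_sub hn₁ hn₂ hc hlazy₁ hlazy₂ hΔ h₁Δ h₂Δ hD hρ hρ1
  have t2 := tendsto_lazyMixture_pow_sub hn₁ hn₂ hc hlazy₁ hlazy₂ hρ hρ1
  refine squeeze_zero (fun _ => norm_nonneg _) (fun n => ?_) (by simpa using t1.add t2)
  exact norm_sub_le_norm_sub_add_norm_sub _ _ _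

end TwoPairs

/-! ### The `ℓ¹`-norm on a real group algebra -/

section L1Norm

/-- The `ℓ¹`-norm of a finitely supported family of coefficients. -/
def l1Norm {E : Type*} (f : MonoidAlgebra ℝ E) : ℝ := ∑' x, |f.coeff x|

variable {E : Type*}

theorem l1Norm_eq_sum (f : MonoidAlgebra ℝ E) :
    l1Norm f = ∑ x ∈ f.coeff.support, |f.coeff x| :=
  tsum_eq_sum fun x hx => by simpa using hx

theorem summable_abs_coeff (f : MonoidAlgebra ℝ E) : Summable fun x => |f.coeff x| :=
  summable_of_ne_finset_zero (s := f.coeff.support) fun x hx => by simpa using hx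

@[simp]
theorem l1Norm_zero : l1Norm (0 : MonoidAlgebra ℝ E) = 0 := by simp [l1Norm]

theorem l1Norm_add_le (f g : MonoidAlgebra ℝ E) : l1Norm (f + g) ≤ l1Norm f + l1Norm g := by
  rw [l1Norm, l1Norm, l1Norm, ← (summable_abs_coeff f).tsum_add (summable_abs_coeff g)]
  exact (summable_abs_coeff (f + g)).tsum_le_tsum (fun x => by simpa using abs_add_le _ _)
    ((summable_abs_coeff f).add (summable_abs_coeff g))

theorem l1Norm_smul (r : ℝ) (f : MonoidAlgebra ℝ E) : l1Norm (r • f) = |r| * l1Norm f := by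
  simp [l1Norm, abs_mul, tsum_mul_left]

theorem l1Norm_single (x : E) (r : ℝ) : l1Norm (MonoidAlgebra.single x r) = |r| := by
  rw [l1Norm, tsum_eq_single x fun y hy => by simp [hy.symm]]
  simp

theorem eq_zero_of_l1Norm_eq_zero {f : MonoidAlgebra ℝ E} (h : l1Norm f = 0) : f = 0 := by
  ext x
  have := (summable_abs_coeff f).le_tsum x fun _ _ => abs_nonneg _
  rw [← l1Norm, h] at this
  simpa using this

theorem l1Norm_sum_le {ι : Type*} (s : Finset ι) (f : ι → MonoidAlgebra ℝ E) :
    l1Norm (∑ i ∈ s, f i) ≤ ∑ i ∈ s, l1Norm (f i) :=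
  Finset.le_sum_of_subadditive l1Norm l1Norm_zero.le l1Norm_add_le s f

/-- The norm is invariant under left translation, which settles the case of a single group element
on the left. -/
theorem l1Norm_mul_le {G : Type*} [Group G] (f g : MonoidAlgebra ℝ G) :
    l1Norm (f * g) ≤ l1Norm f * l1Norm g := by
  have hsingle : ∀ (x : G) (r : ℝ), l1Norm (MonoidAlgebra.single x r * g) = |r| * l1Norm g := by
    intro x r
    simp only [l1Norm, MonoidAlgebra.coeff_single_mul_apply, abs_mul, tsum_mul_left]
    exact congrArg _ ((Equiv.mulLeft x⁻¹).tsum_eq fun y => |g.coeff y|)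
  conv_lhs => rw [← MonoidAlgebra.sum_coeff_single f]
  rw [Finsupp.sum, Finset.sum_mul, l1Norm_eq_sum f, Finset.sum_mul]
  exact (l1Norm_sum_le _ _).trans (Finset.sum_le_sum fun x _ => (hsingle x _).le)

variable (G : Type*) [Group G]

/-- The `ℓ¹`-norm as a ring norm on the group algebra. -/
def l1RingNorm : RingNorm (MonoidAlgebra ℝ G) where
  toFun := l1Norm
  map_zero' := l1Norm_zero
  add_le' := l1Norm_add_le
  neg' f := by simp [l1Norm]
  mul_le' := l1Norm_mul_le
  eq_zero_of_map_eq_zero' _ := eq_zero_of_l1Norm_eq_zero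

/-- The group algebra as a normed ring for the `ℓ¹`-norm. -/
abbrev l1NormedRing : NormedRing (MonoidAlgebra ℝ G) := (l1RingNorm G).toNormedRing

attribute [local instance] l1NormedRing

theorem norm_eq_l1Norm (f : MonoidAlgebra ℝ G) : ‖f‖ = l1Norm f := rfl

/-- The group algebra as a normed algebra for the `ℓ¹`-norm. -/
abbrev l1NormedAlgebra : NormedAlgebra ℝ (MonoidAlgebra ℝ G) where
  norm_smul_le r f := by
    rw [norm_eq_l1Norm, norm_eq_l1Norm, l1Norm_smul, Real.norm_eq_abs]

attribute [local instance] l1NormedAlgebra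

theorem l1_normOneClass : NormOneClass (MonoidAlgebra ℝ G) :=
  ⟨by rw [norm_eq_l1Norm, MonoidAlgebra.one_def, l1Norm_single, abs_one]⟩

end L1Norm

/-! ### Finitely supported laws as elements of the group algebra -/

section Coefficients

/-- The masses of the law `p` are the coefficients of `f`. -/
def HasCoeffs {E : Type*} (p : PMF E) (f : MonoidAlgebra ℝ E) : Prop :=
  ∀ x, (p x).toReal = f.coeff x

variable {E F : Type*}

theorem HasCoeffs.l1Dist_eq {p q : PMF E} {f g : MonoidAlgebra ℝ E} (hp : HasCoeffs p f)
    (hq : HasCoeffs q g) : l1Dist p q = l1Norm (f - g) := by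
  simp [l1Dist, l1Norm, hp _, hq _]

theorem HasCoeffs.of_eq {p : PMF E} {f g : MonoidAlgebra ℝ E} (h : HasCoeffs p f) (e : f = g) :
    HasCoeffs p g := e ▸ h

theorem hasCoeffs_pure (x : E) : HasCoeffs (PMF.pure x) (MonoidAlgebra.single x 1) := by
  classical
  intro y
  rw [PMF.pure_apply, MonoidAlgebra.coeff_single, Finsupp.single_apply]
  by_cases h : x = y
  · simp [h]
  · simp [h, Ne.symm h]

theorem toReal_bind_apply (p : PMF E) (q : E → PMF F) (y : F) :
    (p.bind q y).toReal = ∑' x, (p x).toReal * (q x y).toReal := by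
  rw [PMF.bind_apply, ENNReal.tsum_toReal_eq]
  · simp only [ENNReal.toReal_mul]
  · exact fun x => ENNReal.mul_ne_top (p.apply_ne_top x) ((q x).apply_ne_top y)

theorem HasCoeffs.bind {p : PMF E} {f : MonoidAlgebra ℝ E} {q : E → PMF F}
    {g : E → MonoidAlgebra ℝ F} (hp : HasCoeffs p f) (hq : ∀ x, HasCoeffs (q x) (g x)) :
    HasCoeffs (p.bind q) (f.coeff.sum fun x c => c • g x) := by
  intro y
  rw [toReal_bind_apply, tsum_eq_sum (s := f.coeff.support)
    fun x hx => by rw [hp x, Finsupp.notMem_support_iff.mp hx, zero_mul]]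
  simp [Finsupp.sum, hp _, hq _ _, Finsupp.finsetSum_apply]

theorem hasCoeffs_bind_fintype [Fintype E] (p : PMF E) {q : E → PMF F}
    {g : E → MonoidAlgebra ℝ F} (hq : ∀ x, HasCoeffs (q x) (g x)) :
    HasCoeffs (p.bind q) (∑ x, (p x).toReal • g x) := by
  intro y
  rw [toReal_bind_apply, tsum_fintype]
  simp [hq _ _, Finsupp.finsetSum_apply]

theorem HasCoeffs.map {p : PMF E} {f : MonoidAlgebra ℝ E} (hp : HasCoeffs p f) (h : E → F) :
    HasCoeffs (p.map h) (MonoidAlgebra.mapDomain h f) := by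
  refine (hp.bind fun x => hasCoeffs_pure (h x)).of_eq ?_
  simp [MonoidAlgebra.mapDomain, Finsupp.mapDomain, MonoidAlgebra.ofCoeff_finsuppSum]

theorem HasCoeffs.walkLaw {G : Type*} [Group G] {μ : PMF G} {m : MonoidAlgebra ℝ G}
    (h : HasCoeffs μ m) (n : ℕ) : HasCoeffs (walkLaw μ n) (m ^ n) := by
  induction n with
  | zero => exact hasCoeffs_pure 1
  | succ n ih =>
    refine (ih.bind fun x => h.map fun s => x * s).of_eq ?_
    rw [pow_succ, MonoidAlgebra.mul_def]
    congr 1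
    funext x c
    simp [MonoidAlgebra.mapDomain, Finsupp.mapDomain, MonoidAlgebra.ofCoeff_finsuppSum,
      Finsupp.smul_sum]

/-- The embedding of the group algebra of `G` in that of `G × G` along the first factor. -/
abbrev inlAlg (G : Type*) [Group G] : MonoidAlgebra ℝ G →ₐ[ℝ] MonoidAlgebra ℝ (G × G) :=
  MonoidAlgebra.mapDomainAlgHom ℝ ℝ (MonoidHom.inl G G)

/-- The embedding of the group algebra of `G` in that of `G × G` along the second factor. -/
abbrev inrAlg (G : Type*) [Group G] : MonoidAlgebra ℝ G →ₐ[ℝ] MonoidAlgebra ℝ (G × G) :=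
  MonoidAlgebra.mapDomainAlgHom ℝ ℝ (MonoidHom.inr G G)

/-- The embedding of the group algebra of `G` in that of `G × G` along the diagonal. -/
abbrev diagAlg (G : Type*) [Group G] : MonoidAlgebra ℝ G →ₐ[ℝ] MonoidAlgebra ℝ (G × G) :=
  MonoidAlgebra.mapDomainAlgHom ℝ ℝ ((MonoidHom.id G).prod (MonoidHom.id G))

variable {G : Type*} [Group G]

theorem commute_inlAlg_inrAlg (f g : MonoidAlgebra ℝ G) : Commute (inlAlg G f) (inrAlg G g) := by
  induction f using MonoidAlgebra.induction_linear with
  | zero => simp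
  | add f f' hf hf' => rw [map_add]; exact hf.add_left hf'
  | single x r =>
    induction g using MonoidAlgebra.induction_linear with
    | zero => simp
    | add g g' hg hg' => rw [map_add]; exact hg.add_right hg'
    | single y s =>
      simp [Commute, SemiconjBy, MonoidAlgebra.single_mul_single, mul_comm]

theorem inlAlg_mul_inrAlg (f g : MonoidAlgebra ℝ G) :
    inlAlg G f * inrAlg G g
      = f.coeff.sum fun x c => c • MonoidAlgebra.mapDomain (fun y => (x, y)) g := by
  conv_lhs => rw [← MonoidAlgebra.sum_coeff_single f, ← MonoidAlgebra.sum_coeff_single g]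
  rw [(commute_inlAlg_inrAlg _ _).eq]
  simp [Finsupp.sum_mul, Finsupp.mul_sum, MonoidAlgebra.single_mul_single,
    MonoidAlgebra.mapDomain, Finsupp.mapDomain, MonoidAlgebra.ofCoeff_finsuppSum, Finsupp.smul_sum,
    mul_comm]

theorem HasCoeffs.prodLaw {μ ν : PMF G} {m k : MonoidAlgebra ℝ G} (h : HasCoeffs μ m)
    (h' : HasCoeffs ν k) : HasCoeffs (prodLaw μ ν) (inlAlg G m * inrAlg G k) := by
  rw [inlAlg_mul_inrAlg]
  exact h.bind fun x => h'.map _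

theorem HasCoeffs.noisedStep {μ : PMF G} {m : MonoidAlgebra ℝ G} (h : HasCoeffs μ m)
    (ρ : unitInterval) :
    HasCoeffs (noisedStep μ ρ)
      ((1 - (ρ : ℝ)) • diagAlg G m + (ρ : ℝ) • (inlAlg G m * inrAlg G m)) := by
  have hd : HasCoeffs (diagLaw μ) (diagAlg G m) := h.map _
  refine (hasCoeffs_bind_fintype (coin ρ)
    (q := fun refreshed => if refreshed then NoiseSensitivity.prodLaw μ μ else diagLaw μ)
    (g := fun refreshed => if refreshed then inlAlg G m * inrAlg G m else diagAlg G m)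
    (by rintro (_ | _); exacts [hd, h.prodLaw h])).of_eq ?_
  have h0 : 0 ≤ 1 - (ρ : ℝ) := by simpa using ρ.2.2
  simp [coin, ENNReal.toReal_ofReal, h0, ρ.2.1, add_comm]

/-- The `ℓ¹`-distance in the definition of noise sensitivity, in the group algebra. -/
theorem HasCoeffs.l1Dist_noisedPairLaw {μ : PMF G} {m : MonoidAlgebra ℝ G} (h : HasCoeffs μ m)
    (ρ : unitInterval) (n : ℕ) :
    l1Dist (noisedPairLaw μ ρ n)
        (NoiseSensitivity.prodLaw (NoiseSensitivity.walkLaw μ n) (NoiseSensitivity.walkLaw μ n))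
      = l1Norm (((1 - (ρ : ℝ)) • diagAlg G m + (ρ : ℝ) • (inlAlg G m * inrAlg G m)) ^ n
          - (inlAlg G m * inrAlg G m) ^ n) := by
  -- The two factors commute, so the product of the walk laws is itself an `n`-th power.
  rw [(commute_inlAlg_inrAlg m m).mul_pow, ← map_pow, ← map_pow]
  exact ((h.noisedStep ρ).walkLaw n).l1Dist_eq ((h.walkLaw n).prodLaw (h.walkLaw n))

end Coefficients

/-! ### Lower bounds from representations -/

section Representation

variable {G A : Type*} [Group G] [NormedRing A] [NormedAlgebra ℝ A]

/-- The linear extension of `(x, y) ↦ σ (x y⁻¹)` to the group algebra of `G × G`. -/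
def quotientMap (σ : G →* A) : MonoidAlgebra ℝ (G × G) →ₗ[ℝ] A where
  toFun f := Finsupp.linearCombination ℝ (fun g : G × G => σ (g.1 * g.2⁻¹)) f.coeff
  map_add' f g := by simp
  map_smul' r f := by simp

theorem quotientMap_single (σ : G →* A) (x y : G) (r : ℝ) :
    quotientMap σ (MonoidAlgebra.single (x, y) r) = r • σ (x * y⁻¹) := by
  simp [quotientMap]

theorem norm_quotientMap_le {σ : G →* A} (hσ : ∀ g, ‖σ g‖ ≤ 1) (f : MonoidAlgebra ℝ (G × G)) :
    ‖quotientMap σ f‖ ≤ l1Norm f := by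
  rw [l1Norm_eq_sum]
  refine (norm_sum_le _ _).trans (Finset.sum_le_sum fun g _ => ?_)
  exact (norm_smul_le _ _).trans (mul_le_of_le_one_right (norm_nonneg _) (hσ _))

/-- `quotientMap` is not multiplicative, but a new increment `(s, r)` enters `x s r⁻¹ y⁻¹` in the
middle, so a scalar mean factors out. -/
theorem quotientMap_pow {σ : G →* A} {p : MonoidAlgebra ℝ (G × G)} {c : ℝ}
    (hp : quotientMap σ p = c • 1) (n : ℕ) : quotientMap σ (p ^ n) = c ^ n • 1 := by
  have hmul : ∀ (x y : G) (r : ℝ) (f : MonoidAlgebra ℝ (G × G)),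
      quotientMap σ (MonoidAlgebra.single (x, y) r * f)
        = r • (σ x * quotientMap σ f * σ y⁻¹) := by
    intro x y r f
    induction f using MonoidAlgebra.induction_linear with
    | zero => simp
    | add f f' hf hf' => rw [mul_add, map_add, hf, hf', map_add, mul_add, add_mul, smul_add]
    | single z s =>
      rw [MonoidAlgebra.single_mul_single, Prod.mk_mul_mk, quotientMap_single,
        show z = (z.1, z.2) from rfl, quotientMap_single]
      simp [mul_smul, mul_assoc]
  have hright : ∀ f : MonoidAlgebra ℝ (G × G), quotientMap σ (f * p) = c • quotientMap σ f := by
    intro f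
    induction f using MonoidAlgebra.induction_linear with
    | zero => simp
    | add f f' hf hf' => rw [add_mul, map_add, hf, hf', map_add, smul_add]
    | single z s =>
      rw [show z = (z.1, z.2) from rfl, hmul, hp, quotientMap_single, mul_smul_comm, mul_one,
        smul_mul_assoc, ← map_mul, smul_comm]
  induction n with
  | zero =>
    rw [pow_zero, pow_zero, MonoidAlgebra.one_def, show (1 : G × G) = (1, 1) from rfl,
      quotientMap_single]
    simp
  | succ n ih => rw [pow_succ, hright, ih, smul_smul, pow_succ']

theorem abs_pow_sub_pow_le_l1Norm [NormOneClass A] {σ : G →* A} (hσ : ∀ g, ‖σ g‖ ≤ 1)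
    {p q : MonoidAlgebra ℝ (G × G)} {c d : ℝ} (hp : quotientMap σ p = c • 1)
    (hq : quotientMap σ q = d • 1) (n : ℕ) : |c ^ n - d ^ n| ≤ l1Norm (p ^ n - q ^ n) := by
  have := norm_quotientMap_le hσ (p ^ n - q ^ n)
  rwa [map_sub, quotientMap_pow hp, quotientMap_pow hq, ← sub_smul, norm_smul, norm_one, mul_one,
    Real.norm_eq_abs] at this

end Representation

end NoiseSensitivity

/-! ### The two walks on the infinite dihedral group. -/

namespace DInfty

open NoiseSensitivity

theorem hasCoeffs_simpleStep : HasCoeffs simpleStep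
    ((1 / 2 : ℝ) • (MonoidAlgebra.single a 1 + MonoidAlgebra.single b 1)) := by
  refine (hasCoeffs_bind_fintype (PMF.uniformOfFintype (Fin 2))
    fun i => hasCoeffs_pure ((![a, b] : Fin 2 → DInfty) i)).of_eq ?_
  simp [Fin.sum_univ_succ]

theorem hasCoeffs_lazyStep : HasCoeffs lazyStep
    ((1 / 3 : ℝ) • (MonoidAlgebra.single a 1 + MonoidAlgebra.single b 1 + 1)) := by
  refine (hasCoeffs_bind_fintype (PMF.uniformOfFintype (Fin 3))
    fun i => hasCoeffs_pure ((![a, b, 1] : Fin 3 → DInfty) i)).of_eq ?_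
  simp [Fin.sum_univ_succ, MonoidAlgebra.one_def, add_assoc]

theorem a_mul_a : a * a = 1 := by
  rw [← sq]
  exact PresentedGroup.one_of_mem (rels := {FreeGroup.of true ^ 2, FreeGroup.of false ^ 2})
    (Set.mem_insert _ _)

theorem b_mul_b : b * b = 1 := by
  rw [← sq]
  exact PresentedGroup.one_of_mem (rels := {FreeGroup.of true ^ 2, FreeGroup.of false ^ 2})
    (Set.mem_insert_of_mem _ rfl)

theorem isL1NoiseSensitive_lazyStep : IsL1NoiseSensitive lazyStep := by
  intro ρ hρ hρ1
  simp only [hasCoeffs_lazyStep.l1Dist_noisedPairLaw]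
  let _ := l1NormedRing (DInfty × DInfty)
  let _ := l1NormedAlgebra (DInfty × DInfty)
  have := l1_normOneClass (DInfty × DInfty)
  have hinv : ∀ x y : DInfty, x * x = 1 → y * y = 1 → ∀ s : DInfty →* DInfty × DInfty,
      IsInvolutionPair (MonoidAlgebra.single (s x) (1 : ℝ)) (MonoidAlgebra.single (s y) 1) := by
    intro x y hx hy s
    refine ⟨?_, ?_, ?_, ?_⟩
    · rw [norm_eq_l1Norm, l1Norm_single, abs_one]
    · rw [norm_eq_l1Norm, l1Norm_single, abs_one]
    · rw [MonoidAlgebra.single_mul_single, ← map_mul, hx, map_one, mul_one, MonoidAlgebra.one_def]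
    · rw [MonoidAlgebra.single_mul_single, ← map_mul, hy, map_one, mul_one, MonoidAlgebra.one_def]
  have hcomm : ∀ x y : DInfty, Commute
      (MonoidAlgebra.single (MonoidHom.inl DInfty DInfty x) (1 : ℝ))
      (MonoidAlgebra.single (MonoidHom.inr DInfty DInfty y) 1) := fun x y =>
    MonoidAlgebra.single_commute_single (MonoidHom.commute_inl_inr x y) (Commute.refl _)
  have h := tendsto_noised_pow_sub (hinv a b a_mul_a b_mul_b (MonoidHom.inl _ _))
    (hinv a b a_mul_a b_mul_b (MonoidHom.inr _ _)) (hcomm _ _) (hcomm _ _) (hcomm _ _) (hcomm _ _)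
    (ρ := ρ) hρ hρ1.le
  refine h.congr fun n => ?_
  rw [norm_eq_l1Norm]
  simp only [map_smul, map_add, map_one, MonoidAlgebra.mapDomainAlgHom_apply,
    MonoidAlgebra.mapDomain_single, MonoidHom.inl_apply, MonoidHom.inr_apply,
    MonoidHom.prod_apply, MonoidHom.id_apply, MonoidAlgebra.single_mul_single, Prod.mk_mul_mk,
    one_mul, mul_one]

/-! ### Planar representations and the simple walk. -/

/-- The action of `D_∞` on the plane in which `a` and `b` are reflections and `b * a` is the
rotation by `ω`. -/
def planeAction (ω : Circle) : DInfty →* (ℂ ≃ₗᵢ[ℝ] ℂ) :=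
  PresentedGroup.toGroup
    (f := fun i => if i then Complex.conjLIE else Complex.conjLIE.trans (rotation ω)) (by
      rintro r (rfl | rfl)
      · ext z
        simp [sq]
      · ext z
        simp [sq, ← Circle.coe_inv_eq_conj])

theorem planeAction_a (ω : Circle) (z : ℂ) : planeAction ω a z = (starRingEnd ℂ) z := by
  simp [planeAction, a, PresentedGroup.toGroup.of]

theorem planeAction_b (ω : Circle) (z : ℂ) : planeAction ω b z = ω * (starRingEnd ℂ) z := by
  simp [planeAction, b, PresentedGroup.toGroup.of]

/-- The representation of `D_∞` underlying `planeAction`. -/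
def planeRep (ω : Circle) : DInfty →* (ℂ →L[ℝ] ℂ) where
  toFun g := (planeAction ω g).toLinearIsometry.toContinuousLinearMap
  map_one' := by rw [map_one]; rfl
  map_mul' g h := by rw [map_mul]; rfl

theorem norm_planeRep_le (ω : Circle) (g : DInfty) : ‖planeRep ω g‖ ≤ 1 :=
  (planeAction ω g).toLinearIsometry.norm_toContinuousLinearMap_le

theorem planeRep_a_mul_b_add (ω : Circle) :
    planeRep ω (a * b) + planeRep ω (b * a) = (2 * (ω : ℂ).re) • 1 := by
  refine ContinuousLinearMap.ext fun z => ?_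
  have h1 : planeRep ω (a * b) z = (starRingEnd ℂ) ω * z := by
    change planeAction ω (a * b) z = _
    rw [map_mul, LinearIsometryEquiv.coe_mul, Function.comp_apply, planeAction_b, planeAction_a]
    simp
  have h2 : planeRep ω (b * a) z = ω * z := by
    change planeAction ω (b * a) z = _
    rw [map_mul, LinearIsometryEquiv.coe_mul, Function.comp_apply, planeAction_a, planeAction_b]
    simp
  rw [add_apply, h1, h2, ← add_mul, add_comm, Complex.add_conj]
  simp

theorem a_inv : a⁻¹ = a := inv_eq_of_mul_eq_one_left a_mul_a

theorem b_inv : b⁻¹ = b := inv_eq_of_mul_eq_one_left b_mul_b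

theorem not_isL1NoiseSensitive_simpleStep : ¬ IsL1NoiseSensitive simpleStep := by
  intro h
  have hhalf : (1 / 2 : ℝ) ∈ unitInterval := by constructor <;> norm_num
  have hlim := h ⟨1 / 2, hhalf⟩ (Subtype.mk_lt_mk.mpr (by norm_num))
    (Subtype.mk_lt_mk.mpr (by norm_num))
  simp only [hasCoeffs_simpleStep.l1Dist_noisedPairLaw] at hlim
  set m : MonoidAlgebra ℝ DInfty :=
    (1 / 2 : ℝ) • (MonoidAlgebra.single a 1 + MonoidAlgebra.single b 1) with hm
  have hdiag : ∀ ω, quotientMap (planeRep ω) (diagAlg DInfty m) = 1 := by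
    intro ω
    rw [hm]
    simp only [map_smul, map_add, MonoidAlgebra.mapDomainAlgHom_apply,
      MonoidAlgebra.mapDomain_single, MonoidHom.prod_apply, MonoidHom.id_apply,
      quotientMap_single, mul_inv_cancel, map_one]
    module
  have hprod : ∀ ω : Circle, quotientMap (planeRep ω) (inlAlg DInfty m * inrAlg DInfty m)
      = (1 / 2 + 1 / 2 * (ω : ℂ).re : ℝ) • 1 := by
    intro ω
    have key := planeRep_a_mul_b_add ω
    have hx : quotientMap (planeRep ω) (inlAlg DInfty m * inrAlg DInfty m)
        = (1 / 4 : ℝ) • ((1 + 1) + (planeRep ω (a * b) + planeRep ω (b * a))) := by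
      rw [hm]
      simp only [map_smul, map_add, MonoidAlgebra.mapDomainAlgHom_apply,
        MonoidAlgebra.mapDomain_single, MonoidHom.inl_apply, MonoidHom.inr_apply,
        smul_mul_assoc, mul_smul_comm, add_mul, mul_add, MonoidAlgebra.single_mul_single,
        Prod.mk_mul_mk, one_mul, mul_one, quotientMap_single, a_inv, b_inv, a_mul_a, b_mul_b,
        map_one]
      module
    rw [hx, key]
    module
  have hbound : ∀ (ω : Circle) (n : ℕ),
      |(3 / 4 + 1 / 4 * (ω : ℂ).re) ^ n - (1 / 2 + 1 / 2 * (ω : ℂ).re) ^ n|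
        ≤ l1Norm (((1 - (1 / 2 : ℝ)) • diagAlg DInfty m
            + (1 / 2 : ℝ) • (inlAlg DInfty m * inrAlg DInfty m)) ^ n
          - (inlAlg DInfty m * inrAlg DInfty m) ^ n) := fun ω n =>
    abs_pow_sub_pow_le_l1Norm (norm_planeRep_le ω)
      (by
        rw [(quotientMap (planeRep ω)).map_add, (quotientMap (planeRep ω)).map_smul,
          (quotientMap (planeRep ω)).map_smul, hdiag, hprod]
        module) (hprod ω) n
  -- The angle varies with `n`: `cos θ = 1 - 4/n` turns the two scalars into `1 - 1/n` and `1 -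
  -- 2/n`.
  have hexp : Tendsto (fun n : ℕ => |(1 + (-1) / (n : ℝ)) ^ n - (1 + (-2) / (n : ℝ)) ^ n|) atTop
      (𝓝 |Real.exp (-1) - Real.exp (-2)|) :=
    ((Real.tendsto_one_add_div_pow_exp (-1)).sub (Real.tendsto_one_add_div_pow_exp (-2))).abs
  have hle : |Real.exp (-1) - Real.exp (-2)| ≤ 0 := by
    refine le_of_tendsto_of_tendsto hexp hlim ?_
    -- From `n = 2` on, `1 - 4/n` lies in `[-1, 1]` and is a cosine.
    filter_upwards [eventually_ge_atTop 2] with n hn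
    have hn' : (2 : ℝ) ≤ n := by exact_mod_cast hn
    have h4 : 4 / (n : ℝ) ≤ 2 := by
      rw [div_le_iff₀ (by linarith)]
      linarith
    have h0 : 0 ≤ 4 / (n : ℝ) := by positivity
    have hre : ((Circle.exp (Real.arccos (1 - 4 / n)) : Circle) : ℂ).re = 1 - 4 / n := by
      rw [Circle.coe_exp, Complex.exp_ofReal_mul_I_re, Real.cos_arccos (by linarith) (by linarith)]
    have hb := hbound (Circle.exp (Real.arccos (1 - 4 / n))) n
    rw [hre] at hb
    have e1 : 3 / 4 + 1 / 4 * (1 - 4 / (n : ℝ)) = 1 + -1 / n := by ring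
    have e2 : 1 / 2 + 1 / 2 * (1 - 4 / (n : ℝ)) = 1 + -2 / n := by ring
    rwa [e1, e2] at hb
  have hlt : Real.exp (-2) < Real.exp (-1) := Real.exp_lt_exp.mpr (by norm_num)
  exact hlt.ne' (sub_eq_zero.mp (abs_nonpos_iff.mp hle))

end DInfty
end

theorem theorem6p1 :
    ¬ NoiseSensitivity.IsL1NoiseSensitive DInfty.simpleStep ∧
      NoiseSensitivity.IsL1NoiseSensitive DInfty.lazyStep :=
  ⟨DInfty.not_isL1NoiseSensitive_simpleStep, DInfty.isL1NoiseSensitive_lazyStep⟩
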